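/- An $\ell$-group is a group with a lattice order that is invariant under left and right multiplication; an $\ell$-homomorphism is a group homomorphism preserving binary joins and meets. An $\ell$-group is representable if it is a subdirect product of totally ordered groups, and Abelian if its group is. A prime subgroup of an $\ell$-group $H$ is a proper, order-convex subgroup and sublattice $\mathfrak p$ of $H$ such that the set of right cosets of $\mathfrak p$ is totally ordered by: $\mathfrak p x\le \mathfrak p y$ if and only if $x\le ty$ for some $t\in\mathfrak p$. The set $\operatorname{Spec} H$ of prime subgroups carries the topology whose open sets are the sets $\{\mathfrak p : A\not\subseteq\mathfrak p\}$, $A\subseteq H$, and $\operatorname{Min} H$ is the subspace of inclusion-minimal prime subgroups. Let $G$ be a partially ordered group (the order is invariant under left and right multiplication), let $\mathsf V$ be the variety of all, of all representable, or of all Abelian $\ell$-groups, and let $\eta\colon G\to F_{\mathsf V}(G)$ be the $\ell$-group free over $G$ in $\mathsf V$: $F_{\mathsf V}(G)\in\mathsf V$, $\eta$ is an order-preserving group homomorphism, and for every order-preserving group homomorphism $p\colon G\to H$ with $H\in\mathsf V$ there is exactly one $\ell$-homomorphism $h\colon F_{\mathsf V}(G)\to H$ with $h\circ\eta=p$. Give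 the subgroup $\eta[G]$ the partial order restricted from $F_{\mathsf V}(G)$. A right order on a partially ordered group $K$ is a submonoid $C\subsetneq K$ with $K=C\cup C^{-1}$, $C\cap C^{-1}=\{\mathrm e\}$ and $\{a\in K : a\ge \mathrm e\}\subseteq C$ (the positive cone of the right-invariant total order $a\le_C b\iff ba^{-1}\in C$, which extends the order of $K$); it is an order if it is closed under conjugation (that is, $\le_C$ is also left invariant). The set of right orders on $K$ has the topology with subbase the sets $\{C: a\in C\}$ and $\{C : a\notin C\}$, $a\in K$, and the set of orders on $K$ has the subspace topology. **Corollary.** If $\mathsf V$ is the variety of all $\ell$-groups, then $\operatorname{Min} F_{\mathsf V}(G)$ is homeomorphic to the space of right orders on $\eta[G]$. If $\mathsf V$ is the variety of representable $\ell$-groups or the variety of Abelian $\ell$-groups, then $\operatorname{Min} F_{\mathsf V}(G)$ is homeomorphic to the space of orders on $\eta[G]$. -/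

import Mathlib

namespace LatticeGroup

universe u

/-! A partially ordered group is a type with `[Group G] [PartialOrder G] [MulLeftMono G]
[MulRightMono G]`; a lattice-ordered group (ℓ-group) is a type with `[Group H] [Lattice H]
[MulLeftMono H] [MulRightMono H]`. Neither is assumed to be commutative. -/

section Classes

/-- A group homomorphism between ℓ-groups is an ℓ-homomorphism if it preserves binary joins and
binary meets. -/
structure IsLHom {H K : Type*} [Group H] [Lattice H] [Group K] [Lattice K] (f : H →* K) :
    Prop where
  map_sup : ∀ a b, f (a ⊔ b) = f a ⊔ f b
  map_inf : ∀ a b, f (a ⊓ b) = f a ⊓ f b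

/-- A class of ℓ-groups. -/
abbrev LClass : Type (u + 1) := ∀ (H : Type u) [Group H] [Lattice H], Prop

/-- The class of all ℓ-groups. -/
def AllLGroups : LClass.{u} := fun _ _ _ => True

/-- The class of Abelian ℓ-groups: the underlying group is commutative. -/
def AbelianLGroups : LClass.{u} := fun H _ _ => ∀ a b : H, a * b = b * a

/-- The class of representable ℓ-groups: subdirect products of totally ordered groups, that is,
there is a point-separating family of surjective ℓ-homomorphisms onto totally ordered groups. -/
def RepresentableLGroups : LClass.{u} := fun H _ _ =>
  ∃ (ι : Type u) (T : ι → Type u) (_ : ∀ i, Group (T i)) (_ : ∀ i, LinearOrder (T i))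
    (_ : ∀ i, MulLeftMono (T i)) (_ : ∀ i, MulRightMono (T i)) (f : ∀ i, H →* T i),
    (∀ i, IsLHom (f i) ∧ Function.Surjective (f i)) ∧
      ∀ a b : H, (∀ i, f i a = f i b) → a = b

end Classes

section Free

/-- Formal ℓ-group terms over a set of generators. -/
inductive Term (G : Type u) : Type u
  | of : G → Term G
  | one : Term G
  | mul : Term G → Term G → Term G
  | inv : Term G → Term G
  | sup : Term G → Term G → Term G
  | inf : Term G → Term G → Term G

/-- Evaluation of a term in an ℓ-group. -/
def Term.eval {G : Type u} {H : Type*} [Group H] [Lattice H] (p : G → H) : Term G → H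
  | .of g => p g
  | .one => 1
  | .mul s t => s.eval p * t.eval p
  | .inv s => (s.eval p)⁻¹
  | .sup s t => s.eval p ⊔ t.eval p
  | .inf s t => s.eval p ⊓ t.eval p

variable (V : LClass.{u}) (G : Type u) [Group G] [PartialOrder G]

/-- Two terms over the partially ordered group `G` are identified if they have the same value under
every positive homomorphism from `G` to an ℓ-group in the class `V`. -/
def termSetoid : Setoid (Term G) where
  r s t := ∀ (H : Type u) [Group H] [Lattice H] [MulLeftMono H] [MulRightMono H], V H →
    ∀ p : G →* H, Monotone p → s.eval p = t.eval p
  iseqv :=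
    { refl := fun _ _ _ _ _ _ _ _ _ => rfl
      symm := fun h H _ _ _ _ hV p hp => (h H hV p hp).symm
      trans := fun h k H _ _ _ _ hV p hp => (h H hV p hp).trans (k H hV p hp) }

/-- The ℓ-group free over the partially ordered group `G` in the class `V`. Its universal property
is proved below. -/
def Free : Type u := Quotient (termSetoid V G)

namespace Free

variable {V G}

/-- The class of a term in the free ℓ-group. -/
def mk (t : Term G) : Free V G := Quotient.mk (termSetoid V G) t

theorem mk_eq {s t : Term G}
    (h : ∀ (H : Type u) [Group H] [Lattice H] [MulLeftMono H] [MulRightMono H], V H →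
      ∀ p : G →* H, Monotone p → s.eval p = t.eval p) : (mk s : Free V G) = mk t :=
  Quotient.sound (s := termSetoid V G) h

theorem ind {P : Free V G → Prop} (h : ∀ t, P (mk t)) (x : Free V G) : P x :=
  Quotient.ind h x

/-- The value of an element of the free ℓ-group under a positive homomorphism. -/
def eval {H : Type u} [Group H] [Lattice H] [MulLeftMono H] [MulRightMono H] (hV : V H)
    (p : G →* H) (hp : Monotone p) : Free V G → H :=
  Quotient.lift (fun t => t.eval p) (fun _ _ h => h H hV p hp)

instance : One (Free V G) := ⟨mk .one⟩

instance : Mul (Free V G) :=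
  ⟨Quotient.map₂ Term.mul fun _ _ h _ _ k H _ _ _ _ hV p hp =>
    congrArg₂ (· * ·) (h H hV p hp) (k H hV p hp)⟩

instance : Inv (Free V G) :=
  ⟨Quotient.map Term.inv fun _ _ h H _ _ _ _ hV p hp => congrArg (·⁻¹) (h H hV p hp)⟩

/-- The join of two elements of the free ℓ-group. -/
def join : Free V G → Free V G → Free V G :=
  Quotient.map₂ Term.sup fun _ _ h _ _ k H _ _ _ _ hV p hp =>
    congrArg₂ (· ⊔ ·) (h H hV p hp) (k H hV p hp)

/-- The meet of two elements of the free ℓ-group. -/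
def meet : Free V G → Free V G → Free V G :=
  Quotient.map₂ Term.inf fun _ _ h _ _ k H _ _ _ _ hV p hp =>
    congrArg₂ (· ⊓ ·) (h H hV p hp) (k H hV p hp)

theorem mk_one : (mk .one : Free V G) = 1 := rfl

theorem mk_mul (s t : Term G) : (mk (.mul s t) : Free V G) = mk s * mk t := rfl

theorem mk_inv (s : Term G) : (mk (.inv s) : Free V G) = (mk s)⁻¹ := rfl

instance : Group (Free V G) :=
  Group.ofLeftAxioms
    (fun a b c => by
      induction a using ind; induction b using ind; induction c using ind
      exact mk_eq fun H _ _ _ _ _ p _ => mul_assoc _ _ _)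
    (fun a => by
      induction a using ind
      exact mk_eq fun H _ _ _ _ _ p _ => one_mul _)
    (fun a => by
      induction a using ind
      exact mk_eq fun H _ _ _ _ _ p _ => inv_mul_cancel _)

/-- The order is the one induced by the lattice operations: `a ≤ b` iff `a ⊔ b = b`. -/
instance : Lattice (Free V G) :=
  letI : Max (Free V G) := ⟨join⟩
  letI : Min (Free V G) := ⟨meet⟩
  Lattice.mk'
    (fun a b => by
      induction a using ind; induction b using ind
      exact mk_eq fun H _ _ _ _ _ p _ => sup_comm _ _)
    (fun a b c => by
      induction a using ind; induction b using ind; induction c using ind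
      exact mk_eq fun H _ _ _ _ _ p _ => sup_assoc _ _ _)
    (fun a b => by
      induction a using ind; induction b using ind
      exact mk_eq fun H _ _ _ _ _ p _ => inf_comm _ _)
    (fun a b c => by
      induction a using ind; induction b using ind; induction c using ind
      exact mk_eq fun H _ _ _ _ _ p _ => inf_assoc _ _ _)
    (fun a b => by
      induction a using ind; induction b using ind
      exact mk_eq fun H _ _ _ _ _ p _ => sup_inf_self)
    (fun a b => by
      induction a using ind; induction b using ind
      exact mk_eq fun H _ _ _ _ _ p _ => inf_sup_self)

theorem mk_sup (s t : Term G) : (mk (.sup s t) : Free V G) = mk s ⊔ mk t := rfl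

theorem mk_inf (s t : Term G) : (mk (.inf s t) : Free V G) = mk s ⊓ mk t := rfl

instance : MulLeftMono (Free V G) :=
  ⟨fun c a b h => by
    rw [← sup_eq_right] at h
    rw [← sup_eq_right]
    have key : c * a ⊔ c * b = c * (a ⊔ b) := by
      induction a using ind; induction b using ind; induction c using ind
      exact mk_eq fun H _ _ _ _ _ p _ => (mul_sup _ _ _).symm
    rw [key, h]⟩

instance : MulRightMono (Free V G) :=
  ⟨fun c a b h => by
    rw [← sup_eq_right] at h
    change a * c ≤ b * c
    rw [← sup_eq_right]
    have key : a * c ⊔ b * c = (a ⊔ b) * c := by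
      induction a using ind; induction b using ind; induction c using ind
      exact mk_eq fun H _ _ _ _ _ p _ => (sup_mul _ _ _).symm
    rw [key, h]⟩

end Free

/-- The universal map from `G` to the ℓ-group free over `G` in the class `V`. -/
def eta : G →* Free V G where
  toFun g := Free.mk (.of g)
  map_one' := Free.mk_eq fun _ _ _ _ _ _ p _ => p.map_one
  map_mul' a b := Free.mk_eq fun _ _ _ _ _ _ p _ => p.map_mul a b

theorem eta_monotone : Monotone (eta V G) := fun a b h => by
  rw [← sup_eq_right]
  exact Free.mk_eq (s := .sup (.of a) (.of b)) (t := .of b)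
    fun H _ _ _ _ _ p hp => sup_eq_right.2 (hp h)

variable {V G}

/-- The ℓ-homomorphism out of the free ℓ-group induced by a positive homomorphism. -/
def Free.lift {H : Type u} [Group H] [Lattice H] [MulLeftMono H] [MulRightMono H] (hV : V H)
    (p : G →* H) (hp : Monotone p) : Free V G →* H where
  toFun := Free.eval hV p hp
  map_one' := rfl
  map_mul' a b := by
    induction a using Free.ind; induction b using Free.ind; rfl

theorem Free.isLHom_lift {H : Type u} [Group H] [Lattice H] [MulLeftMono H] [MulRightMono H]
    (hV : V H) (p : G →* H) (hp : Monotone p) : IsLHom (Free.lift hV p hp) where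
  map_sup a b := by
    induction a using Free.ind; induction b using Free.ind; rfl
  map_inf a b := by
    induction a using Free.ind; induction b using Free.ind; rfl

/-- The universal property of `eta V G : G → Free V G`. -/
theorem Free.existsUnique_lift {H : Type u} [Group H] [Lattice H] [MulLeftMono H]
    [MulRightMono H] (hV : V H) (p : G →* H) (hp : Monotone p) :
    ∃! h : Free V G →* H, IsLHom h ∧ h.comp (eta V G) = p := by
  refine ⟨Free.lift hV p hp, ⟨Free.isLHom_lift hV p hp, MonoidHom.ext fun _ => rfl⟩, ?_⟩
  rintro h ⟨hl, rfl⟩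
  ext x
  induction x using Free.ind with
  | h t =>
    change h (Free.mk t) = t.eval (h.comp (eta V G))
    induction t with
    | of g => rfl
    | one => exact h.map_one
    | mul s t hs ht => rw [Free.mk_mul, map_mul, hs, ht]; rfl
    | inv s hs => rw [Free.mk_inv, map_inv, hs]; rfl
    | sup s t hs ht => rw [Free.mk_sup, hl.map_sup, hs, ht]; rfl
    | inf s t hs ht => rw [Free.mk_inf, hl.map_inf, hs, ht]; rfl

variable (G)

theorem allLGroups_free : AllLGroups (Free AllLGroups G) := trivial

theorem abelianLGroups_free : AbelianLGroups (Free AbelianLGroups G) := fun a b => by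
  induction a using Free.ind; induction b using Free.ind
  exact Free.mk_eq fun H _ _ _ _ hV p _ => hV _ _

theorem representableLGroups_free :
    RepresentableLGroups (Free RepresentableLGroups G) := by
  have key : ∀ i : {x : Free RepresentableLGroups G × Free RepresentableLGroups G // x.1 ≠ x.2},
      ∃ (T : Type u) (_ : Group T) (_ : LinearOrder T) (_ : MulLeftMono T) (_ : MulRightMono T)
        (f : Free RepresentableLGroups G →* T),
        (IsLHom f ∧ Function.Surjective f) ∧ f i.1.1 ≠ f i.1.2 := by
    rintro ⟨⟨x, y⟩, hxy⟩
    induction x using Free.ind with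
    | h s =>
    induction y using Free.ind with
    | h t =>
    have h1 : ¬ ∀ (H : Type u) [Group H] [Lattice H] [MulLeftMono H] [MulRightMono H],
        RepresentableLGroups H → ∀ p : G →* H, Monotone p → s.eval p = t.eval p :=
      fun h => hxy (Free.mk_eq h)
    push Not at h1
    obtain ⟨H, _, _, _, _, hV, p, hp, hne⟩ := h1
    have hV' := hV
    obtain ⟨ι, T, _, _, _, _, f, hf, hsep⟩ := hV
    obtain ⟨i, hi⟩ : ∃ i, f i (s.eval p) ≠ f i (t.eval p) := by
      by_contra! hcon
      exact hne (hsep _ _ hcon)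
    have hl := Free.isLHom_lift (V := RepresentableLGroups) hV' p hp
    let g : Free RepresentableLGroups G →* T i := (f i).comp (Free.lift hV' p hp)
    let hm : MulLeftMono g.range := ⟨fun c a b h => mul_le_mul_right (α := T i) h c⟩
    let hm' : MulRightMono g.range := ⟨fun c a b h => mul_le_mul_left (α := T i) h c⟩
    have gs : ∀ a b, g (a ⊔ b) = g a ⊔ g b := fun a b => by
      simp only [g, MonoidHom.comp_apply, hl.map_sup, (hf i).1.map_sup]
    have gi : ∀ a b, g (a ⊓ b) = g a ⊓ g b := fun a b => by
      simp only [g, MonoidHom.comp_apply, hl.map_inf, (hf i).1.map_inf]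
    have gm : Monotone g.rangeRestrict := fun a b h => by
      change g a ≤ g b
      rw [← sup_eq_right, ← gs, sup_eq_right.2 h]
    refine ⟨g.range, inferInstance, inferInstance, hm, hm', g.rangeRestrict,
      ⟨⟨fun a b => ?_, fun a b => ?_⟩, g.rangeRestrict_surjective⟩, fun h => hi ?_⟩
    · rcases le_total (g.rangeRestrict a) (g.rangeRestrict b) with h | h
      · rw [sup_eq_right.2 h]
        exact Subtype.ext ((gs a b).trans (sup_eq_right.2 h))
      · rw [sup_eq_left.2 h]
        exact Subtype.ext ((gs a b).trans (sup_eq_left.2 h))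
    · rcases le_total (g.rangeRestrict a) (g.rangeRestrict b) with h | h
      · rw [inf_eq_left.2 h]
        exact Subtype.ext ((gi a b).trans (inf_eq_left.2 h))
      · rw [inf_eq_right.2 h]
        exact Subtype.ext ((gi a b).trans (inf_eq_right.2 h))
    · exact congrArg Subtype.val h
  choose T i1 i2 i3 i4 f hf hne using key
  refine ⟨_, T, i1, i2, i3, i4, f, hf, fun a b h => ?_⟩
  by_contra hab
  exact hne ⟨(a, b), hab⟩ (h _)

end Free

section Spectrum

variable {H : Type*} [Group H] [Lattice H]

/-- A prime subgroup of an ℓ-group: a proper, order-convex sublattice subgroup `p` such that the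
right cosets of `p` are totally ordered by `p x ≤ p y` iff `x ≤ t y` for some `t ∈ p`. -/
structure IsPrimeSubgroup (p : Subgroup H) : Prop where
  sup_mem : ∀ a ∈ p, ∀ b ∈ p, a ⊔ b ∈ p
  inf_mem : ∀ a ∈ p, ∀ b ∈ p, a ⊓ b ∈ p
  convex : ∀ a ∈ p, ∀ b ∈ p, ∀ x, a ≤ x → x ≤ b → x ∈ p
  ne_top : p ≠ ⊤
  total : ∀ x y, (∃ t ∈ p, x ≤ t * y) ∨ (∃ t ∈ p, y ≤ t * x)

theorem IsPrimeSubgroup.mem_of_mabs_mem [MulLeftMono H] [MulRightMono H] {p : Subgroup H}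
    (hp : IsPrimeSubgroup p) {a : H} (h : |a|ₘ ∈ p) : a ∈ p :=
  hp.convex _ (p.inv_mem h) _ h _ (inv_le_of_inv_le' (inv_le_mabs a)) (le_mabs_self a)

theorem IsPrimeSubgroup.mabs_mem {p : Subgroup H} (hp : IsPrimeSubgroup p) {a : H} (h : a ∈ p) :
    |a|ₘ ∈ p :=
  hp.sup_mem _ h _ (p.inv_mem h)

theorem IsPrimeSubgroup.mem_or_mem [MulLeftMono H] [MulRightMono H] {p : Subgroup H}
    (hp : IsPrimeSubgroup p) {a b : H} (h : |a|ₘ ⊓ |b|ₘ ∈ p) : a ∈ p ∨ b ∈ p := by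
  have key : ∀ x y : H, |x|ₘ ⊓ |y|ₘ ∈ p → (∃ t ∈ p, |x|ₘ ≤ t * |y|ₘ) → x ∈ p := by
    rintro x y hxy ⟨t, ht, hle⟩
    refine hp.mem_of_mabs_mem (hp.convex 1 p.one_mem _ (p.mul_mem (hp.mabs_mem ht) hxy) _
      (one_le_mabs x) ?_)
    rw [mul_inf]
    refine le_inf ?_ (hle.trans ?_)
    · exact le_mul_of_one_le_left' (one_le_mabs t)
    · exact mul_le_mul_left (le_mabs_self t) _
  rcases hp.total |a|ₘ |b|ₘ with h' | h'
  · exact Or.inl (key a b h h')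
  · exact Or.inr (key b a (by rwa [inf_comm]) h')

variable (H)

/-- The spectrum of an ℓ-group: the set of its prime subgroups. -/
def Spec : Type _ := {p : Subgroup H // IsPrimeSubgroup p}

/-- The spectral topology: the open sets are the sets `{p | ¬ A ⊆ p}` for subsets `A` of `H`. -/
instance [MulLeftMono H] [MulRightMono H] : TopologicalSpace (Spec H) where
  IsOpen U := ∃ A : Set H, U = {p | ¬ A ⊆ (p.1 : Set H)}
  isOpen_univ := ⟨Set.univ, by
    ext p
    simp only [Set.mem_univ, Set.mem_ofPred_eq, true_iff, Set.univ_subset_iff]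
    exact fun h => p.2.ne_top (SetLike.coe_injective (by simpa using h))⟩
  isOpen_inter := by
    rintro _ _ ⟨A, rfl⟩ ⟨B, rfl⟩
    refine ⟨{c | ∃ a ∈ A, ∃ b ∈ B, c = |a|ₘ ⊓ |b|ₘ}, ?_⟩
    ext p
    simp only [Set.mem_inter_iff, Set.mem_ofPred_eq, Set.not_subset]
    constructor
    · rintro ⟨⟨a, ha, hap⟩, b, hb, hbp⟩
      exact ⟨_, ⟨a, ha, b, hb, rfl⟩, fun h => (p.2.mem_or_mem h).elim hap hbp⟩
    · rintro ⟨_, ⟨a, ha, b, hb, rfl⟩, hc⟩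
      have h1 : (1 : H) ≤ |a|ₘ ⊓ |b|ₘ := le_inf (one_le_mabs a) (one_le_mabs b)
      exact ⟨⟨a, ha, fun h => hc (p.2.convex 1 p.1.one_mem _ (p.2.mabs_mem h) _ h1 inf_le_left)⟩,
        b, hb, fun h => hc (p.2.convex 1 p.1.one_mem _ (p.2.mabs_mem h) _ h1 inf_le_right)⟩
  isOpen_sUnion := by
    intro S hS
    refine ⟨⋃₀ {A | {p : Spec H | ¬ A ⊆ (p.1 : Set H)} ∈ S}, ?_⟩
    ext p
    simp only [Set.mem_sUnion, Set.mem_ofPred_eq, Set.sUnion_subset_iff, not_forall]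
    constructor
    · rintro ⟨U, hU, hp⟩
      obtain ⟨A, rfl⟩ := hS U hU
      exact ⟨A, hU, hp⟩
    · rintro ⟨A, hA, hp⟩
      exact ⟨_, hA, hp⟩

/-- The minimal spectrum of an ℓ-group: the inclusion-minimal prime subgroups. -/
def MinSpec : Type _ := {p : Spec H // Minimal (IsPrimeSubgroup (H := H)) p.1}

/-- The subspace topology inherited from the spectrum. -/
instance [MulLeftMono H] [MulRightMono H] : TopologicalSpace (MinSpec H) :=
  inferInstanceAs (TopologicalSpace {p : Spec H // Minimal (IsPrimeSubgroup (H := H)) p.1})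

end Spectrum

section Orders

variable {G : Type*} [Group G] [PartialOrder G]

/-- The positive cones of the right orders on a partially ordered group `G`, that is, of the
right-invariant total orders on `G` that extend its partial order and are not all of `G × G`. The
right order with positive cone `C` is `a ≤ b` iff `b * a⁻¹ ∈ C`. -/
structure IsRightOrderCone (C : Submonoid G) : Prop where
  ne_top : C ≠ ⊤
  total : ∀ a, a ∈ C ∨ a⁻¹ ∈ C
  of_one_le : ∀ a, 1 ≤ a → a ∈ C
  antisymm : ∀ a, a ∈ C → a⁻¹ ∈ C → a = 1

variable (G)

/-- The space of right orders on a partially ordered group. -/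
def RightOrders : Type _ := {C : Submonoid G // IsRightOrderCone C}

/-- The sets `{C | a ∈ C}` and `{C | a ∉ C}`, for `a` in `G`, form a subbase. -/
instance : TopologicalSpace (RightOrders G) :=
  TopologicalSpace.generateFrom
    {U | ∃ a : G, U = {C : RightOrders G | a ∈ C.1} ∨ U = {C : RightOrders G | a ∉ C.1}}

/-- The space of orders on a partially ordered group: the right orders that are also left
invariant, that is, those whose positive cone is closed under conjugation. -/
def Orders : Type _ := {C : RightOrders G // ∀ a ∈ C.1, ∀ g : G, g * a * g⁻¹ ∈ C.1}

/-- The subspace topology inherited from the space of right orders. -/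
instance : TopologicalSpace (Orders G) :=
  inferInstanceAs
    (TopologicalSpace {C : RightOrders G // ∀ a ∈ C.1, ∀ g : G, g * a * g⁻¹ ∈ C.1})

end Orders

end LatticeGroup

open LatticeGroup

namespace LatticeGroup

section Cones

variable {H : Type*} [Group H] [Lattice H]

/-- The largest subgroup contained in a submonoid of a group. -/
def core {K : Type*} [Group K] (P : Submonoid K) : Subgroup K where
  carrier := {x | x ∈ P ∧ x⁻¹ ∈ P}
  one_mem' := ⟨P.one_mem, by simp [P.one_mem]⟩
  mul_mem' {a b} ha hb := ⟨P.mul_mem ha.1 hb.1, by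
    rw [mul_inv_rev]; exact P.mul_mem hb.2 ha.2⟩
  inv_mem' {a} ha := ⟨ha.2, by simpa using ha.1⟩

theorem mem_core {K : Type*} [Group K] {P : Submonoid K} {x : K} :
    x ∈ core P ↔ x ∈ P ∧ x⁻¹ ∈ P := Iff.rfl

/-- A prime cone of an ℓ-group: the elements `x` with `p ≤ p x`, for a prime subgroup `p`. -/
structure IsPrimeCone (P : Submonoid H) : Prop where
  ne_top : P ≠ ⊤
  total : ∀ a, a ∈ P ∨ a⁻¹ ∈ P
  of_one_le : ∀ a, 1 ≤ a → a ∈ P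
  inf_mem : ∀ a ∈ P, ∀ b ∈ P, a ⊓ b ∈ P

namespace IsPrimeCone

variable {P : Submonoid H}

theorem of_le [MulLeftMono H] (hP : IsPrimeCone P) {a b : H} (ha : a ∈ P) (h : a ≤ b) : b ∈ P := by
  have := P.mul_mem ha (hP.of_one_le (a⁻¹ * b) (by simpa using h))
  simpa using this

variable [MulLeftMono H] [MulRightMono H]

theorem sup_mem_core (hP : IsPrimeCone P) {a b : H} (ha : a⁻¹ ∈ P) (hb : b ∈ core P) :
    a ⊔ b ∈ core P :=
  ⟨hP.of_le hb.1 le_sup_right, by rw [inv_sup]; exact hP.inf_mem _ ha _ hb.2⟩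

theorem inf_mem_core (hP : IsPrimeCone P) {a b : H} (ha : a ∈ P) (hb : b ∈ core P) :
    a ⊓ b ∈ core P :=
  ⟨hP.inf_mem _ ha _ hb.1, hP.of_le hb.2 (inv_le_inv_iff.2 inf_le_right)⟩

theorem inf_one_mem_core (hP : IsPrimeCone P) {x : H} : x ⊓ 1 ∈ core P ↔ x ∈ P :=
  ⟨fun h => hP.of_le h.1 inf_le_left, fun h => hP.inf_mem_core h (core P).one_mem⟩

theorem isPrimeSubgroup_core (hP : IsPrimeCone P) : IsPrimeSubgroup (core P) where
  sup_mem a ha b hb := hP.sup_mem_core ha.2 hb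
  inf_mem a ha b hb := hP.inf_mem_core ha.1 hb
  convex a ha b hb x hax hxb := ⟨hP.of_le ha.1 hax, hP.of_le hb.2 (inv_le_inv_iff.2 hxb)⟩
  ne_top h := hP.ne_top (eq_top_iff.2 fun x _ =>
    ((h ▸ Subgroup.mem_top x : x ∈ core P)).1)
  total x y := by
    have key : ∀ x y : H, y * x⁻¹ ∈ P → ∃ t ∈ core P, x ≤ t * y := fun x y h => by
      refine ⟨(y * x⁻¹ ⊓ 1)⁻¹, (core P).inv_mem (hP.inf_one_mem_core.2 h), ?_⟩
      rw [le_inv_mul_iff_mul_le, inf_mul]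
      exact inf_le_left.trans (by simp)
    rcases hP.total (y * x⁻¹) with h | h
    · exact Or.inl (key x y h)
    · exact Or.inr (key y x (by simpa using h))

end IsPrimeCone

variable [MulLeftMono H] [MulRightMono H]

/-- The prime cone of a prime subgroup. -/
def IsPrimeSubgroup.cone {p : Subgroup H} (hp : IsPrimeSubgroup p) : Submonoid H where
  carrier := {x | x ⊓ 1 ∈ p}
  one_mem' := by simp [p.one_mem]
  mul_mem' {a b} ha hb := by
    refine hp.convex _ (p.mul_mem ha hb) 1 p.one_mem _ (le_inf ?_ ?_) inf_le_right
    · exact mul_le_mul' inf_le_left inf_le_left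
    · exact mul_le_one' inf_le_right inf_le_right

theorem IsPrimeSubgroup.mem_cone {p : Subgroup H} (hp : IsPrimeSubgroup p) {x : H} :
    x ∈ hp.cone ↔ x ⊓ 1 ∈ p := Iff.rfl

theorem IsPrimeSubgroup.core_cone {p : Subgroup H} (hp : IsPrimeSubgroup p) :
    core hp.cone = p := by
  ext x
  rw [mem_core, hp.mem_cone, hp.mem_cone]
  constructor
  · rintro ⟨h1, h2⟩
    refine hp.convex _ h1 _ (p.inv_mem h2) x inf_le_left ?_
    rw [inv_inf, inv_inv]
    exact le_sup_left
  · exact fun h => ⟨hp.inf_mem _ h _ p.one_mem, hp.inf_mem _ (p.inv_mem h) _ p.one_mem⟩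

theorem IsPrimeSubgroup.isPrimeCone_cone {p : Subgroup H} (hp : IsPrimeSubgroup p) :
    IsPrimeCone hp.cone where
  ne_top h := hp.ne_top (by
    rw [← hp.core_cone, h]
    exact eq_top_iff.2 fun _ _ => ⟨trivial, trivial⟩)
  total a := by
    rcases hp.total 1 a with ⟨t, ht, h⟩ | ⟨t, ht, h⟩
    · refine Or.inl (hp.convex _ (hp.inf_mem _ (p.inv_mem ht) _ p.one_mem) _ p.one_mem _ ?_
        inf_le_right)
      exact inf_le_inf_right _ (inv_le_iff_one_le_mul'.2 h)
    · refine Or.inr (hp.convex _ (hp.inf_mem _ (p.inv_mem ht) _ p.one_mem) _ p.one_mem _ ?_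
        inf_le_right)
      exact inf_le_inf_right _ (inv_le_inv_iff.2 (by simpa using h))
  of_one_le a ha := by
    rw [hp.mem_cone, inf_eq_right.2 ha]
    exact p.one_mem
  inf_mem a ha b hb := by
    rw [hp.mem_cone, inf_inf_distrib_right]
    exact hp.inf_mem _ ha _ hb

theorem IsPrimeCone.cone_core {P : Submonoid H} (hP : IsPrimeCone P) :
    hP.isPrimeSubgroup_core.cone = P := by
  ext x
  rw [IsPrimeSubgroup.mem_cone, hP.inf_one_mem_core]

end Cones

section Values

variable {H : Type*} [Group H] [Lattice H] [MulLeftMono H] [MulRightMono H]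

theorem inf_mul_le_inf_mul_inf {c d e : H} (hc : 1 ≤ c) (hd : 1 ≤ d) (he : 1 ≤ e) :
    c ⊓ d * e ≤ (c ⊓ d) * (c ⊓ e) := by
  rw [mul_inf, inf_mul, inf_mul]
  refine le_inf (le_inf ?_ ?_) (le_inf ?_ inf_le_right)
  · exact inf_le_left.trans (le_mul_of_one_le_left' hc)
  · exact inf_le_left.trans (le_mul_of_one_le_left' hd)
  · exact inf_le_left.trans (le_mul_of_one_le_right' he)

/-- The positive cones of the convex ℓ-subgroups of an ℓ-group. -/
structure IsConvexCone (S : Set H) : Prop where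
  one_le : ∀ a ∈ S, 1 ≤ a
  one_mem : 1 ∈ S
  mul_mem : ∀ a ∈ S, ∀ b ∈ S, a * b ∈ S
  of_le : ∀ a ∈ S, ∀ b, 1 ≤ b → b ≤ a → b ∈ S

/-- The elements whose meet with `d` lies in a given convex cone. -/
theorem IsConvexCone.colon {S : Set H} (hS : IsConvexCone S) {d : H} (hd : 1 ≤ d) :
    IsConvexCone {y | 1 ≤ y ∧ d ⊓ y ∈ S} where
  one_le a h := h.1
  one_mem := ⟨le_rfl, by simpa [inf_eq_right.2 hd] using hS.one_mem⟩
  mul_mem a ha b hb := ⟨one_le_mul ha.1 hb.1, hS.of_le _ (hS.mul_mem _ ha.2 _ hb.2) _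
    (le_inf hd (one_le_mul ha.1 hb.1)) (inf_mul_le_inf_mul_inf hd ha.1 hb.1)⟩
  of_le a ha b hb hba := ⟨hb, hS.of_le _ ha.2 _ (le_inf hd hb) (inf_le_inf_left _ hba)⟩

theorem exists_isConvexCone_prime {x : H} (hx : 1 < x) :
    ∃ S : Set H, IsConvexCone S ∧ x ∉ S ∧
      ∀ a b, 1 ≤ a → 1 ≤ b → a ⊓ b ∈ S → a ∈ S ∨ b ∈ S := by
  obtain ⟨S, -, hS⟩ := zorn_subset_nonempty {S : Set H | IsConvexCone S ∧ x ∉ S} (by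
    rintro c hc hch ⟨S₀, hS₀⟩
    refine ⟨⋃₀ c, ⟨⟨?_, ⟨S₀, hS₀, (hc hS₀).1.one_mem⟩, ?_, ?_⟩, ?_⟩,
      fun s hs => Set.subset_sUnion_of_mem hs⟩
    · rintro a ⟨S, hS, ha⟩
      exact (hc hS).1.one_le a ha
    · rintro a ⟨S, hS, ha⟩ b ⟨T, hT, hb⟩
      rcases hch.total hS hT with h | h
      · exact ⟨T, hT, (hc hT).1.mul_mem a (h ha) b hb⟩
      · exact ⟨S, hS, (hc hS).1.mul_mem a ha b (h hb)⟩
    · rintro a ⟨S, hS, ha⟩ b h1 h2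
      exact ⟨S, hS, (hc hS).1.of_le a ha b h1 h2⟩
    · rintro ⟨S, hS, h⟩
      exact (hc hS).2 h) {1} ⟨⟨by simp, by simp, by simp, by
        rintro a rfl b h1 h2; exact le_antisymm h2 h1⟩, by simpa using hx.ne'⟩
  refine ⟨S, hS.prop.1, hS.prop.2, fun a b ha hb hab => ?_⟩
  by_contra! hcon
  have step : ∀ d e, 1 ≤ d → 1 ≤ e → d ⊓ e ∈ S → e ∉ S → d ⊓ x ∈ S := by
    intro d e hd he hde heS
    by_contra hdx
    have hle : S ⊆ {y | 1 ≤ y ∧ d ⊓ y ∈ S} := fun y hy =>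
      have h1 := hS.prop.1.one_le y hy
      ⟨h1, hS.prop.1.of_le y hy _ (le_inf hd h1) inf_le_right⟩
    exact heS (hS.le_of_ge ⟨hS.prop.1.colon hd, fun h => hdx h.2⟩ hle ⟨he, hde⟩)
  have h1 := step b a hb ha (by rwa [inf_comm]) hcon.1
  have h2 := step x b hx.le hb (by rwa [inf_comm]) hcon.2
  exact hS.prop.2 (by simpa using h2)

theorem exists_isPrimeCone_notMem_core {x : H} (hx : x ≠ 1) :
    ∃ P : Submonoid H, IsPrimeCone P ∧ x ∉ core P := by
  obtain ⟨S, hS, hxS, hprime⟩ := exists_isConvexCone_prime (x := |x|ₘ)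
    (lt_of_le_of_ne (one_le_mabs x) fun h => hx (by
      have h1 : x ≤ 1 := (le_mabs_self x).trans h.ge
      have h2 : x⁻¹ ≤ 1 := (inv_le_mabs x).trans h.ge
      exact le_antisymm h1 (by simpa using h2)))
  let P : Submonoid H :=
    { carrier := {y | y⁻ᵐ ∈ S}
      one_mem' := by simpa using hS.one_mem
      mul_mem' := fun {a b} ha hb => by
        refine hS.of_le _ (hS.mul_mem _ hb _ ha) _ (one_le_leOnePart _) ?_
        rw [leOnePart_def, mul_inv_rev]
        exact sup_le (mul_le_mul' (inv_le_leOnePart b) (inv_le_leOnePart a))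
          (one_le_mul (one_le_leOnePart b) (one_le_leOnePart a)) }
  have hxP : x ∉ core P := fun h => hxS (by
    have h2 : x⁻¹⁻ᵐ * x⁻ᵐ ∈ S := hS.mul_mem _ h.2 _ h.1
    rwa [leOnePart_inv, oneLePart_mul_leOnePart] at h2)
  refine ⟨P, ⟨fun h => hxP (h ▸ ⟨trivial, trivial⟩), fun a => ?_, fun a ha => ?_,
    fun a ha b hb => ?_⟩, hxP⟩
  · refine (hprime a⁻ᵐ a⁻¹⁻ᵐ (one_le_leOnePart _) (one_le_leOnePart _) ?_)
    rw [leOnePart_inv, inf_comm, oneLePart_inf_leOnePart_eq_one]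
    exact hS.one_mem
  · change a⁻ᵐ ∈ S
    rw [leOnePart_eq_one.2 ha]
    exact hS.one_mem
  · refine hS.of_le _ (hS.mul_mem _ ha _ hb) _ (one_le_leOnePart _) ?_
    rw [leOnePart_min]
    exact sup_le (le_mul_of_one_le_right' (one_le_leOnePart _))
      (le_mul_of_one_le_left' (one_le_leOnePart _))

end Values

section Ultraproduct

variable {H : Type*} [Group H] [Lattice H] [MulLeftMono H] [MulRightMono H]

/-- A prime subgroup contains one that comes from an ultraproduct of a separating family. -/
theorem IsPrimeSubgroup.exists_ultrafilter {p : Subgroup H} (hp : IsPrimeSubgroup p) {ι : Type*}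
    {P : ι → Submonoid H} (hP : ∀ i, IsPrimeCone (P i)) (hsep : ∀ x, x ≠ 1 → ∃ i, x ∉ core (P i)) :
    ∃ (U : Ultrafilter ι) (Q : Submonoid H), IsPrimeCone Q ∧
      (∀ x, x ∈ Q ↔ ∀ᶠ i in (U : Filter ι), x ∈ P i) ∧ core Q ≤ p := by
  obtain ⟨x₀, hx₀⟩ : ∃ x, x ∉ p := by
    by_contra! h
    exact hp.ne_top (eq_top_iff.2 fun x _ => h x)
  let F : Filter ι :=
    { sets := {A | ∃ x, x ∉ p ∧ {i | x ∉ core (P i)} ⊆ A}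
      univ_sets := ⟨x₀, hx₀, Set.subset_univ _⟩
      sets_of_superset := fun ⟨x, hx, hA⟩ hAB => ⟨x, hx, hA.trans hAB⟩
      inter_sets := by
        rintro A B ⟨x, hx, hA⟩ ⟨y, hy, hB⟩
        refine ⟨|x|ₘ ⊓ |y|ₘ, fun h => (hp.mem_or_mem h).elim hx hy, fun i hi => ⟨hA fun h => hi ?_,
          hB fun h => hi ?_⟩⟩
        · have hc := (hP i).isPrimeSubgroup_core
          exact hc.convex 1 (one_mem _) _ (hc.mabs_mem h) _
            (le_inf (one_le_mabs x) (one_le_mabs y)) inf_le_left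
        · have hc := (hP i).isPrimeSubgroup_core
          exact hc.convex 1 (one_mem _) _ (hc.mabs_mem h) _
            (le_inf (one_le_mabs x) (one_le_mabs y)) inf_le_right }
  have hF : F.NeBot := Filter.neBot_iff.2 fun h => by
    obtain ⟨x, hx, hA⟩ : (∅ : Set ι) ∈ F := by rw [h]; trivial
    obtain ⟨i, hi⟩ := hsep x fun h => hx (h ▸ p.one_mem)
    exact hA hi
  obtain ⟨U, hU⟩ := Ultrafilter.exists_le F
  let Q : Submonoid H :=
    { carrier := {x | ∀ᶠ i in (U : Filter ι), x ∈ P i}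
      one_mem' := Filter.Eventually.of_forall fun i => (P i).one_mem
      mul_mem' := fun ha hb => by
        filter_upwards [ha, hb] with i h1 h2 using (P i).mul_mem h1 h2 }
  have hQ : core Q ≤ p := fun x hx => by
    by_contra hxp
    have h1 : ∀ᶠ i in (U : Filter ι), x ∉ core (P i) := hU ⟨x, hxp, subset_rfl⟩
    obtain ⟨i, h2, h3, h4⟩ := (h1.and (hx.1.and hx.2)).exists
    exact h2 ⟨h3, h4⟩
  refine ⟨U, Q, ⟨fun h => hx₀ (hQ (h ▸ ⟨trivial, trivial⟩)), fun a => ?_,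
    fun a ha => Filter.Eventually.of_forall fun i => (hP i).of_one_le a ha, fun a ha b hb => ?_⟩,
    fun x => Iff.rfl, hQ⟩
  · exact Ultrafilter.eventually_or.1 (Filter.Eventually.of_forall fun i => (hP i).total a)
  · filter_upwards [ha, hb] with i h1 h2 using (hP i).inf_mem _ h1 _ h2

end Ultraproduct

section TotalCones

variable {E : Type*} [Group E] [PartialOrder E]

/-- The positive cones of the right-invariant total preorders that extend the partial order of a
group and are invariant under conjugation by the elements of `K`. -/
structure IsTotalCone (K : Subgroup E) (M : Submonoid E) : Prop where
  total : ∀ a, a ∈ M ∨ a⁻¹ ∈ M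
  of_one_le : ∀ a, 1 ≤ a → a ∈ M
  conj_mem : ∀ a ∈ M, ∀ g ∈ K, g * a * g⁻¹ ∈ M

/-- The lexicographic refinement of a total preorder by another one. -/
theorem IsTotalCone.refine {K : Subgroup E} {M N : Submonoid E} (hM : IsTotalCone K M)
    (hN : IsTotalCone K N) :
    ∃ L ≤ M, IsTotalCone K L ∧ ∀ a ∈ core L, a ∈ core N := by
  let L : Submonoid E :=
    { carrier := {a | a ∈ M ∧ (a⁻¹ ∈ M → a ∈ N)}
      one_mem' := ⟨M.one_mem, fun _ => N.one_mem⟩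
      mul_mem' := fun {a b} ha hb => ⟨M.mul_mem ha.1 hb.1, fun h => by
        rw [mul_inv_rev] at h
        refine N.mul_mem (ha.2 ?_) (hb.2 ?_)
        · simpa using M.mul_mem hb.1 h
        · simpa using M.mul_mem h ha.1⟩ }
  refine ⟨L, fun a ha => ha.1, ⟨fun a => ?_, fun a ha => ⟨hM.of_one_le a ha,
    fun _ => hN.of_one_le a ha⟩, fun a ha g hg => ⟨hM.conj_mem a ha.1 g hg, fun h => ?_⟩⟩,
    fun a ha => ⟨ha.1.2 ha.2.1, ha.2.2 (by simpa using ha.1.1)⟩⟩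
  · by_cases h1 : a ∈ M <;> by_cases h2 : a⁻¹ ∈ M
    · rcases hN.total a with h | h
      · exact Or.inl ⟨h1, fun _ => h⟩
      · exact Or.inr ⟨h2, fun _ => h⟩
    · exact Or.inl ⟨h1, fun h => absurd h h2⟩
    · exact Or.inr ⟨h2, fun h => absurd (by simpa using h) h1⟩
    · exact ((hM.total a).elim h1 h2).elim
  · refine hN.conj_mem a (ha.2 ?_) g hg
    have := hM.conj_mem _ h g⁻¹ (K.inv_mem hg)
    simpa [mul_assoc] using this

theorem exists_isRightOrderCone_le [Nontrivial E] {K : Subgroup E} {ι : Type*}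
    {N : ι → Submonoid E} (hN : ∀ i, IsTotalCone K (N i)) (hsep : ∀ x, x ≠ 1 → ∃ i, x ∉ core (N i))
    {M : Submonoid E} (hM : IsTotalCone K M) :
    ∃ C ≤ M, IsRightOrderCone C ∧ ∀ a ∈ C, ∀ g ∈ K, g * a * g⁻¹ ∈ C := by
  obtain ⟨C, hCM, hC⟩ := zorn_le_nonempty₀ (α := (Submonoid E)ᵒᵈ)
    {M | IsTotalCone K (OrderDual.ofDual M)} (by
      intro c hc hch y hy
      have key : IsTotalCone K (sInf (OrderDual.toDual ⁻¹' c)) := by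
        refine ⟨fun a => ?_, fun a ha => ?_, fun a ha g hg => ?_⟩
        · by_contra! h
          simp only [Submonoid.mem_sInf, not_forall] at h
          obtain ⟨⟨A, hA, ha⟩, B, hB, hb⟩ := h
          rcases hch.total hA hB with hAB | hAB
          · exact ((hc hB).total a).elim (fun h => ha (hAB h)) hb
          · exact ((hc hA).total a).elim ha fun h => hb (hAB h)
        · exact Submonoid.mem_sInf.2 fun A hA => (hc hA).of_one_le a ha
        · exact Submonoid.mem_sInf.2 fun A hA =>
            (hc hA).conj_mem a (Submonoid.mem_sInf.1 ha A hA) g hg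
      exact ⟨OrderDual.toDual (sInf (OrderDual.toDual ⁻¹' c)), key, fun z hz =>
        show sInf (OrderDual.toDual ⁻¹' c) ≤ OrderDual.ofDual z from sInf_le hz⟩)
    (OrderDual.toDual M) hM
  have hCt : IsTotalCone K (OrderDual.ofDual C) := hC.prop
  have anti : ∀ a, a ∈ OrderDual.ofDual C → a⁻¹ ∈ OrderDual.ofDual C → a = 1 := by
    intro a h1 h2
    by_contra hne
    obtain ⟨i, hi⟩ := hsep a hne
    obtain ⟨L, hLC, hL, hLN⟩ := hCt.refine (hN i)
    have hCL : OrderDual.ofDual C ≤ L := hC.le_of_ge (y := OrderDual.toDual L) hL hLC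
    exact hi (hLN a ⟨hCL h1, hCL h2⟩)
  refine ⟨OrderDual.ofDual C, hCM, ⟨fun h => ?_, hCt.total, hCt.of_one_le, anti⟩, hCt.conj_mem⟩
  obtain ⟨a, ha⟩ := exists_ne (1 : E)
  exact ha (anti a (h ▸ trivial) (h ▸ trivial))

end TotalCones

section Generation

variable {H : Type*} [Group H] [Lattice H]

/-- A subgroup generates an ℓ-group if every property that holds on the subgroup and is preserved
by the ℓ-group operations holds everywhere. -/
def LGenerates (E : Subgroup H) : Prop :=
  ∀ Q : H → Prop, (∀ e ∈ E, Q e) → (∀ x y, Q x → Q y → Q (x * y)) → (∀ x, Q x → Q x⁻¹) →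
    (∀ x y, Q x → Q y → Q (x ⊔ y)) → (∀ x y, Q x → Q y → Q (x ⊓ y)) → ∀ x, Q x

variable [MulLeftMono H] [MulRightMono H] {E : Subgroup H}

/-- If the positions of the elements of a generating subgroup `E` with respect to a family of prime
cones stabilize along a filter, then eventually every element is in the same coset as some element
of `E`, which can be chosen uniformly. -/
theorem LGenerates.exists_eventually_mem_core (hE : LGenerates E) {ι : Type*} {l : Filter ι}
    {P : ι → Submonoid H} (hP : ∀ i, IsPrimeCone (P i))
    (hl : ∀ e ∈ E, (∀ᶠ i in l, e ∈ P i) ∨ ∀ᶠ i in l, e⁻¹ ∈ P i) (x : H) :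
    ∃ e ∈ E, ∀ᶠ i in l, x * e⁻¹ ∈ core (P i) := by
  let Q : H → Prop := fun x => ∀ c ∈ E, ∃ e ∈ E, ∀ᶠ i in l, c * x * e⁻¹ ∈ core (P i)
  have q_mul : ∀ x y, Q x → Q y → Q (x * y) := fun x y hx hy c hc => by
    obtain ⟨d, hd, h1⟩ := hx c hc
    obtain ⟨e, he, h2⟩ := hy d hd
    refine ⟨e, he, ?_⟩
    filter_upwards [h1, h2] with i h1 h2
    simpa [mul_assoc] using mul_mem h1 h2
  have q_sup : ∀ x y, Q x → Q y → Q (x ⊔ y) := fun x y hx hy c hc => by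
    obtain ⟨d, hd, h1⟩ := hx c hc
    obtain ⟨e, he, h2⟩ := hy c hc
    rcases hl (e * d⁻¹) (E.mul_mem he (E.inv_mem hd)) with h | h
    · refine ⟨e, he, ?_⟩
      filter_upwards [h, h1, h2] with i h h1 h2
      rw [mul_sup, sup_mul]
      refine (hP i).sup_mem_core ?_ h2
      simpa [mul_assoc] using (P i).mul_mem h h1.2
    · refine ⟨d, hd, ?_⟩
      filter_upwards [h, h1, h2] with i h h1 h2
      rw [mul_sup, sup_mul, sup_comm]
      refine (hP i).sup_mem_core ?_ h1
      simpa [mul_assoc] using (P i).mul_mem h h2.2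
  have q_inf : ∀ x y, Q x → Q y → Q (x ⊓ y) := fun x y hx hy c hc => by
    obtain ⟨d, hd, h1⟩ := hx c hc
    obtain ⟨e, he, h2⟩ := hy c hc
    rcases hl (d * e⁻¹) (E.mul_mem hd (E.inv_mem he)) with h | h
    · refine ⟨e, he, ?_⟩
      filter_upwards [h, h1, h2] with i h h1 h2
      rw [mul_inf, inf_mul]
      refine (hP i).inf_mem_core ?_ h2
      simpa [mul_assoc] using (P i).mul_mem h1.1 h
    · refine ⟨d, hd, ?_⟩
      filter_upwards [h, h1, h2] with i h h1 h2
      rw [mul_inf, inf_mul, inf_comm]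
      refine (hP i).inf_mem_core ?_ h1
      simpa [mul_assoc] using (P i).mul_mem h2.1 h
  have q_coe : ∀ e ∈ E, Q e := fun e he c hc =>
    ⟨c * e, E.mul_mem hc he, Filter.Eventually.of_forall fun i => by simp [one_mem]⟩
  have key : Q x ∧ Q x⁻¹ := by
    refine hE (fun x => Q x ∧ Q x⁻¹) (fun e he => ⟨q_coe e he, q_coe _ (E.inv_mem he)⟩)
      (fun x y hx hy => ⟨q_mul x y hx.1 hy.1, ?_⟩) (fun x hx => ⟨hx.2, by simpa using hx.1⟩)
      (fun x y hx hy => ⟨q_sup x y hx.1 hy.1, ?_⟩) (fun x y hx hy => ⟨q_inf x y hx.1 hy.1, ?_⟩) x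
    · rw [mul_inv_rev]
      exact q_mul _ _ hy.2 hx.2
    · rw [inv_sup]
      exact q_inf _ _ hx.2 hy.2
    · rw [inv_inf]
      exact q_sup _ _ hx.2 hy.2
  simpa using key.1 1 E.one_mem

/-- A prime cone is determined, in an order-preserving way, by its trace on a generating
subgroup. -/
theorem LGenerates.core_le_core (hE : LGenerates E) {P Q : Submonoid H} (hP : IsPrimeCone P)
    (hQ : IsPrimeCone Q) (h : ∀ e ∈ E, e ∈ P → e ∈ Q) : core P ≤ core Q := by
  intro x hx
  obtain ⟨e, he, hxe⟩ := hE.exists_eventually_mem_core (l := ⊤)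
    (P := fun b : Bool => if b then P else Q) (by intro b; cases b <;> simp [hP, hQ])
    (fun e he => by
      rcases hP.total e with h1 | h1
      · exact Or.inl (by simpa [Filter.eventually_top] using ⟨h e he h1, h1⟩)
      · exact Or.inr (by simpa [Filter.eventually_top] using ⟨h _ (E.inv_mem he) h1, h1⟩)) x
  rw [Filter.eventually_top] at hxe
  have h1 : x * e⁻¹ ∈ core P := by simpa using hxe true
  have h2 : x * e⁻¹ ∈ core Q := by simpa using hxe false
  have h3 : e ∈ core P := by
    rw [mul_mem_cancel_left hx] at h1
    simpa using h1
  have h4 : e ∈ core Q := ⟨h e he h3.1, h _ (E.inv_mem he) h3.2⟩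
  simpa using mul_mem h2 h4

theorem LGenerates.exists_notMem_core (hE : LGenerates E) {P : Submonoid H} (hP : IsPrimeCone P) :
    ∃ e ∈ E, e ∉ core P := by
  by_contra! h
  refine hP.isPrimeSubgroup_core.ne_top (eq_top_iff.2 fun x _ => ?_)
  obtain ⟨e, he, hx⟩ := hE.exists_eventually_mem_core (l := ⊤) (P := fun _ : Unit => P)
    (fun _ => hP) (fun e he => Or.inl (Filter.Eventually.of_forall fun _ => (h e he).1)) x
  rw [Filter.eventually_top] at hx
  simpa using mul_mem (hx ()) (h e he)

end Generation

section Homeomorphism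

variable {H : Type*} [Group H] [Lattice H] {E : Subgroup H}

/-- The trace of a prime cone on a subgroup. -/
theorem IsPrimeCone.isTotalCone_comap {P : Submonoid H} (hP : IsPrimeCone P) {K : Subgroup E}
    (hK : ∀ a ∈ P, ∀ g ∈ K, (g : H) * a * (g : H)⁻¹ ∈ P) :
    IsTotalCone K (P.comap E.subtype) where
  total a := hP.total a
  of_one_le a ha := hP.of_one_le a ha
  conj_mem a ha g hg := hK a ha g hg

variable [MulLeftMono H] [MulRightMono H]

/-- The minimal spectrum of an ℓ-group with a generating subgroup `E`, as a space of right orders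
on `E`. -/
theorem nonempty_minSpec_homeomorph (hE : LGenerates E) (K : Subgroup E) {ι : Type*}
    {N : ι → Submonoid H} (hN : ∀ i, IsPrimeCone (N i))
    (hK : ∀ i, ∀ a ∈ N i, ∀ g ∈ K, (g : H) * a * (g : H)⁻¹ ∈ N i)
    (hsep : ∀ x, x ≠ 1 → ∃ i, x ∉ core (N i))
    (hex : ∀ C : RightOrders E, (∀ a ∈ C.1, ∀ g ∈ K, g * a * g⁻¹ ∈ C.1) →
      ∃ P : Submonoid H, IsPrimeCone P ∧ P.comap E.subtype = C.1) :
    Nonempty (MinSpec H ≃ₜ {C : RightOrders E // ∀ a ∈ C.1, ∀ g ∈ K, g * a * g⁻¹ ∈ C.1}) := by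
  let O := {C : RightOrders E // ∀ a ∈ C.1, ∀ g ∈ K, g * a * g⁻¹ ∈ C.1}
  choose P hP hPC using fun C : O => hex C.1 C.2
  have hPmem : ∀ (C : O) (e : E), (e : H) ∈ P C ↔ e ∈ C.1.1 := fun C e => by rw [← hPC C]; rfl
  have hPcore : ∀ (C : O) (e : E), (e : H) ∈ core (P C) ↔ e = 1 := fun C e => by
    refine ⟨fun h => C.1.2.antisymm e ((hPmem C e).1 h.1) ((hPmem C e⁻¹).1 h.2), ?_⟩
    rintro rfl
    exact one_mem _
  have hmin : ∀ C : O, Minimal (IsPrimeSubgroup (H := H)) (core (P C)) := fun C => by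
    refine ⟨(hP C).isPrimeSubgroup_core, fun q hq hle => ?_⟩
    rw [← hq.core_cone]
    refine hE.core_le_core (hP C) hq.isPrimeCone_cone fun e he h => ?_
    by_contra hn
    have h1 : e⁻¹ ∈ hq.cone := (hq.isPrimeCone_cone.total e).resolve_left hn
    have h2 : e⁻¹ ∈ P C := ((hP C).inf_one_mem_core).1 (hle h1)
    have h3 : (⟨e, he⟩ : E) = 1 := (hPcore C ⟨e, he⟩).1 ⟨h, h2⟩
    exact hn (by rw [show e = 1 from congrArg Subtype.val h3]; exact one_mem _)
  have hcone : ∀ p : MinSpec H, ∃ C : O, P C = p.1.2.cone := by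
    rintro ⟨⟨p, hp⟩, hpm : Minimal (IsPrimeSubgroup (H := H)) p⟩
    change ∃ C : O, P C = hp.cone
    obtain ⟨U, Q, hQ, hQU, hQp⟩ := hp.exists_ultrafilter hN hsep
    obtain rfl : p = core Q := hpm.eq_of_ge hQ.isPrimeSubgroup_core hQp
    rw [show hp.cone = Q from hQ.cone_core]
    have hQK : ∀ a ∈ Q, ∀ g ∈ K, (g : H) * a * (g : H)⁻¹ ∈ Q := fun a ha g hg => by
      rw [hQU] at ha ⊢
      filter_upwards [ha] with i hi using hK i a hi g hg
    have hnt : Nontrivial E := by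
      obtain ⟨e, he, h⟩ := hE.exists_notMem_core hQ
      refine ⟨⟨e, he⟩, 1, fun h1 => h ?_⟩
      rw [show e = 1 from congrArg Subtype.val h1]
      exact one_mem _
    obtain ⟨C, hCQ, hC, hCK⟩ := exists_isRightOrderCone_le
      (fun i => (hN i).isTotalCone_comap (hK i))
      (fun x hx => hsep x fun h => hx (Subtype.ext h)) (hQ.isTotalCone_comap hQK)
    let C' : O := ⟨⟨C, hC⟩, hCK⟩
    refine ⟨C', ?_⟩
    have hle : core (P C') ≤ core Q := hE.core_le_core (hP C') hQ fun e he h =>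
      hCQ ((hPmem C' ⟨e, he⟩).1 h)
    have heq : core (P C') = core Q := (hpm.eq_of_ge (hP C').isPrimeSubgroup_core hle).symm
    ext x
    rw [← (hP C').inf_one_mem_core, heq, hQ.inf_one_mem_core]
  choose f hf using hcone
  let g : O → MinSpec H := fun C => ⟨⟨core (P C), (hP C).isPrimeSubgroup_core⟩, hmin C⟩
  have hgcone : ∀ C, (g C).1.2.cone = P C := fun C => (hP C).cone_core
  have hfmem : ∀ (p : MinSpec H) (e : E), e ∈ (f p).1.1 ↔ (e : H) ⊓ 1 ∈ p.1.1 := fun p e => by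
    rw [← hPmem, hf]
    rfl
  refine ⟨{ toFun := f, invFun := g, left_inv := fun p => ?_, right_inv := fun C => ?_,
            continuous_toFun := ?_, continuous_invFun := ?_ }⟩
  · refine Subtype.ext (Subtype.ext ?_)
    change core (P (f p)) = p.1.1
    rw [hf, IsPrimeSubgroup.core_cone]
  · refine Subtype.ext (Subtype.ext ?_)
    ext e
    rw [← hPmem, hf, hgcone, hPmem]
  · have hopen : ∀ x : H, IsOpen {p : MinSpec H | x ∉ p.1.1} := fun x =>
      ⟨{p : Spec H | x ∉ p.1}, ⟨{x}, by simp⟩, rfl⟩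
    refine Continuous.subtype_mk (continuous_generateFrom_iff.2 ?_) _
    have hnot : ∀ e : E, IsOpen {p : MinSpec H | e ∉ (f p).1.1} := fun e => by
      simp only [hfmem]
      exact hopen _
    rintro _ ⟨e, rfl | rfl⟩
    · change IsOpen {p : MinSpec H | e ∈ (f p).1.1}
      by_cases he : e = 1
      · simp [he, one_mem]
      · convert hnot e⁻¹ using 3 with p
        refine ⟨fun h h' => he ((f p).1.2.antisymm e h h'), fun h => ?_⟩
        exact ((f p).1.2.total e).resolve_right h
    · exact hnot e
  · refine Continuous.subtype_mk ⟨?_⟩ _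
    rintro _ ⟨A, rfl⟩
    rw [isOpen_iff_eventually]
    intro C hC
    obtain ⟨a, haA, ha⟩ := Set.not_subset.1 (show ¬ A ⊆ (core (P C) : Set H) from hC)
    have hmem : ∀ e : E, IsOpen {C : O | e ∈ C.1.1} := fun e => by
      have h : IsOpen {C : RightOrders E | e ∈ C.1} :=
        TopologicalSpace.isOpen_generateFrom_of_mem ⟨e, Or.inl rfl⟩
      exact h.preimage continuous_subtype_val
    obtain ⟨e, he, hev⟩ := hE.exists_eventually_mem_core (l := nhds C) hP (fun e he => by
      have hev : ∀ e : E, (e : H) ∈ P C → ∀ᶠ D in nhds C, (e : H) ∈ P D := fun e h => by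
        simp only [hPmem] at h ⊢
        exact (hmem e).mem_nhds h
      exact ((hP C).total e).imp (hev ⟨e, he⟩) (hev (⟨e, he⟩ : E)⁻¹)) a
    have key : ∀ D : O, a * e⁻¹ ∈ core (P D) → (a ∈ core (P D) ↔ e = 1) := fun D hD => by
      have h1 : e ∈ core (P D) ↔ e = 1 := by simpa [Subtype.ext_iff] using hPcore D ⟨e, he⟩
      rw [← h1]
      exact ⟨fun h => by simpa using (mul_mem_cancel_left h).1 hD,
        fun h => by simpa using mul_mem hD h⟩
    filter_upwards [hev] with D hD
    exact Set.not_subset.2 ⟨a, haA, fun h => ha ((key C hev.self_of_nhds).2 ((key D hD).1 h))⟩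

end Homeomorphism

universe u

section ChainAutomorphisms

variable {Ω : Type*} [LinearOrder Ω]

/-- The pointwise order on the automorphisms of a chain. -/
instance : PartialOrder (Ω ≃o Ω) := PartialOrder.lift (fun f : Ω ≃o Ω => (f : Ω → Ω))
  DFunLike.coe_injective

theorem orderIso_le_def {f g : Ω ≃o Ω} : f ≤ g ↔ ∀ x, f x ≤ g x := Iff.rfl

/-- The pointwise maximum of two automorphisms of a chain. -/
def orderIsoSup (f g : Ω ≃o Ω) : Ω ≃o Ω :=
  StrictMono.orderIsoOfRightInverse (fun x => f x ⊔ g x)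
    (fun _ _ h => max_lt_max (f.strictMono h) (g.strictMono h))
    (fun x => f.symm x ⊓ g.symm x) (fun x => by
      rcases le_total (f.symm x) (g.symm x) with h | h
      · simpa [inf_eq_left.2 h] using g.le_symm_apply.1 h
      · simpa [inf_eq_right.2 h] using f.le_symm_apply.1 h)

/-- The pointwise minimum of two automorphisms of a chain. -/
def orderIsoInf (f g : Ω ≃o Ω) : Ω ≃o Ω :=
  StrictMono.orderIsoOfRightInverse (fun x => f x ⊓ g x)
    (fun _ _ h => min_lt_min (f.strictMono h) (g.strictMono h))
    (fun x => f.symm x ⊔ g.symm x) (fun x => by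
      rcases le_total (f.symm x) (g.symm x) with h | h
      · simpa [sup_eq_right.2 h] using f.symm_apply_le.1 h
      · simpa [sup_eq_left.2 h] using g.symm_apply_le.1 h)

/-- The automorphisms of a chain form an ℓ-group under the pointwise order. -/
instance : Lattice (Ω ≃o Ω) where
  sup := orderIsoSup
  le_sup_left f g := fun x => le_max_left (f x) (g x)
  le_sup_right f g := fun x => le_max_right (f x) (g x)
  sup_le _ _ _ h1 h2 := fun x => max_le (h1 x) (h2 x)
  inf := orderIsoInf
  inf_le_left f g := fun x => min_le_left (f x) (g x)
  inf_le_right f g := fun x => min_le_right (f x) (g x)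
  le_inf _ _ _ h1 h2 := fun x => le_min (h1 x) (h2 x)

theorem orderIso_inf_apply (f g : Ω ≃o Ω) (x : Ω) : (f ⊓ g) x = f x ⊓ g x := rfl

instance : MulLeftMono (Ω ≃o Ω) := ⟨fun h _ _ hfg x => h.monotone (hfg x)⟩

instance : MulRightMono (Ω ≃o Ω) := ⟨fun h _ _ hfg x => hfg (h x)⟩

/-- The automorphisms of a chain that do not move a given point down. -/
def pointCone (ω : Ω) : Submonoid (Ω ≃o Ω) where
  carrier := {f | ω ≤ f ω}
  one_mem' := le_rfl
  mul_mem' {f _} hf hg := hf.trans (f.monotone hg)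

theorem mem_pointCone {ω : Ω} {f : Ω ≃o Ω} : f ∈ pointCone ω ↔ ω ≤ f ω := Iff.rfl

end ChainAutomorphisms

section Pullback

variable {H A : Type*} [Group H] [Lattice H] [Group A] [Lattice A]

theorem IsLHom.monotone {f : H →* A} (hf : IsLHom f) : Monotone f := fun a b h => by
  rw [← sup_eq_right, ← hf.map_sup, sup_eq_right.2 h]

theorem IsLHom.isPrimeCone_comap {f : H →* A} (hf : IsLHom f) {Q : Submonoid A}
    (htotal : ∀ a, a ∈ Q ∨ a⁻¹ ∈ Q) (hone : ∀ a, 1 ≤ a → a ∈ Q)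
    (hinf : ∀ a ∈ Q, ∀ b ∈ Q, a ⊓ b ∈ Q) (hne : ∃ x, f x ∉ Q) : IsPrimeCone (Q.comap f) where
  ne_top h := hne.elim fun x hx => hx (h ▸ trivial : x ∈ Q.comap f)
  total a := by simpa using htotal (f a)
  of_one_le a ha := hone _ (by simpa using hf.monotone ha)
  inf_mem a ha b hb := by
    rw [Submonoid.mem_comap, hf.map_inf]
    exact hinf _ ha _ hb

/-- An ℓ-homomorphism to a totally ordered group defines a conjugation-invariant prime cone. -/
theorem IsLHom.exists_isPrimeCone {T : Type*} [Group T] [LinearOrder T] [MulLeftMono T]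
    [MulRightMono T] {f : H →* T} (hf : IsLHom f) (hne : ∃ x, f x ≠ 1) :
    ∃ P : Submonoid H, IsPrimeCone P ∧ (∀ a ∈ P, ∀ g, g * a * g⁻¹ ∈ P) ∧
      ∀ x, x ∈ P ↔ 1 ≤ f x := by
  refine ⟨(Submonoid.oneLE T).comap f, hf.isPrimeCone_comap (fun a => ?_) (fun a ha => ha)
    (fun a ha b hb => le_inf ha hb) ?_, fun a ha g => ?_, fun x => Iff.rfl⟩
  · simpa using le_total 1 a
  · obtain ⟨x, hx⟩ := hne
    rcases lt_or_gt_of_ne hx with h | h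
    · exact ⟨x, not_le.2 h⟩
    · exact ⟨x⁻¹, not_le.2 (by simpa using h)⟩
  · have h1 : 1 ≤ f a := ha
    change 1 ≤ f (g * a * g⁻¹)
    rw [map_mul, map_mul, map_inv, ← mul_inv_cancel (f g)]
    exact mul_le_mul_left (le_mul_of_one_le_right' h1) _

end Pullback

section OrderedChain

variable {E : Type*} [Group E] [PartialOrder E]

/-- A group with the left-invariant total order `a ≤ b` iff `a⁻¹ * b ∈ C`, for a right order with
positive cone `C`. -/
def RightOrders.Chain (_ : RightOrders E) : Type _ := E

namespace RightOrders

variable (C : RightOrders E)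

instance : Group C.Chain := inferInstanceAs (Group E)

/-- The identity map from a group to the chain of a right order. -/
def toChain : E ≃* C.Chain := MulEquiv.refl E

noncomputable instance : LinearOrder C.Chain where
  le a b := C.toChain.symm (a⁻¹ * b) ∈ C.1
  le_refl a := by simp [C.1.one_mem]
  le_trans a b c h1 h2 := by simpa [mul_assoc] using C.1.mul_mem h1 h2
  le_antisymm a b h1 h2 := by
    have h := C.2.antisymm _ h1 (by simpa using h2)
    rw [map_eq_one_iff C.toChain.symm C.toChain.symm.injective, inv_mul_eq_one] at h
    exact h
  le_total a b := by simpa using C.2.total (C.toChain.symm (a⁻¹ * b))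
  toDecidableLE := Classical.decRel _

theorem toChain_le {a b : E} : C.toChain a ≤ C.toChain b ↔ a⁻¹ * b ∈ C.1 := Iff.rfl

theorem one_le_toChain {a : E} : 1 ≤ C.toChain a ↔ a ∈ C.1 := by
  rw [← map_one C.toChain, toChain_le]
  simp

instance : MulLeftMono C.Chain := ⟨fun c a b h => by
  change C.toChain.symm ((c * a)⁻¹ * (c * b)) ∈ C.1
  simpa [mul_assoc] using (show C.toChain.symm (a⁻¹ * b) ∈ C.1 from h)⟩

theorem mulRightMono_chain (hC : ∀ a ∈ C.1, ∀ g, g * a * g⁻¹ ∈ C.1) : MulRightMono C.Chain :=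
  ⟨fun c a b h => by
    change C.toChain.symm ((a * c)⁻¹ * (b * c)) ∈ C.1
    simpa [mul_assoc] using hC _ h (C.toChain.symm c)⁻¹⟩

theorem toChain_monotone [MulLeftMono E] : Monotone C.toChain := fun a b h =>
  C.toChain_le.2 (C.2.of_one_le _ (by simpa using h))

/-- The action of a right-ordered group on itself by left multiplication. -/
noncomputable def mulLeftHom : E →* (C.Chain ≃o C.Chain) where
  toFun e := OrderIso.mulLeft (C.toChain e)
  map_one' := by ext x; simp
  map_mul' a b := by ext x; simp [mul_assoc]

theorem mulLeftHom_apply (e : E) (x : C.Chain) : C.mulLeftHom e x = C.toChain e * x := rfl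

theorem mulLeftHom_monotone [MulLeftMono E] [MulRightMono E] : Monotone C.mulLeftHom :=
  fun a b h => orderIso_le_def.2 fun x => by
    obtain ⟨x, rfl⟩ := C.toChain.surjective x
    rw [mulLeftHom_apply, mulLeftHom_apply, ← map_mul, ← map_mul]
    exact C.toChain_monotone (mul_le_mul_left h x)

end RightOrders

end OrderedChain

section FreeGeneration

variable (V : LClass.{u}) (G : Type u) [Group G] [PartialOrder G]

theorem lGenerates_range_eta : LGenerates (eta V G).range := fun Q he hm hi hs hf x => by
  induction x using Free.ind with
  | h t =>
    induction t with
    | of g => exact he _ ⟨g, rfl⟩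
    | one => exact he _ (one_mem _)
    | mul s t h1 h2 => exact hm _ _ h1 h2
    | inv s h => exact hi _ h
    | sup s t h1 h2 => exact hs _ _ h1 h2
    | inf s t h1 h2 => exact hf _ _ h1 h2

instance subgroupMulLeftMono {H : Type*} [Group H] [PartialOrder H] [MulLeftMono H]
    (E : Subgroup H) : MulLeftMono E := ⟨fun c _ _ h => mul_le_mul_right (α := H) h c⟩

instance subgroupMulRightMono {H : Type*} [Group H] [PartialOrder H] [MulRightMono H]
    (E : Subgroup H) : MulRightMono E := ⟨fun c _ _ h => mul_le_mul_left (α := H) h c⟩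

variable {V G}

/-- Every monotone homomorphism from the image of `G` to a member of `V` extends to the free
ℓ-group. -/
theorem exists_isLHom_extension {A : Type u} [Group A] [Lattice A] [MulLeftMono A]
    [MulRightMono A] (hV : V A) (p : (eta V G).range →* A) (hp : Monotone p) :
    ∃ f : Free V G →* A, IsLHom f ∧ ∀ e : (eta V G).range, f e = p e := by
  have hm : Monotone (p.comp (eta V G).rangeRestrict) := fun a b h => hp (eta_monotone V G h)
  refine ⟨Free.lift hV _ hm, Free.isLHom_lift hV _ hm, ?_⟩
  rintro ⟨_, g, rfl⟩
  rfl

theorem exists_isPrimeCone_of_allLGroups (C : RightOrders (eta AllLGroups G).range) :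
    ∃ P : Submonoid (Free AllLGroups G), IsPrimeCone P ∧
      P.comap (eta AllLGroups G).range.subtype = C.1 := by
  obtain ⟨f, hf, hfe⟩ := exists_isLHom_extension (V := AllLGroups) trivial C.mulLeftHom
    C.mulLeftHom_monotone
  have hmem : ∀ e : (eta AllLGroups G).range,
      f e ∈ pointCone (1 : C.Chain) ↔ e ∈ C.1 := fun e => by
    rw [hfe, mem_pointCone, C.mulLeftHom_apply, mul_one, C.one_le_toChain]
  refine ⟨(pointCone (1 : C.Chain)).comap f, hf.isPrimeCone_comap (fun a => ?_) (fun a ha => ha 1)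
    (fun a ha b hb => ?_) ?_, Submonoid.ext hmem⟩
  · rw [mem_pointCone, mem_pointCone]
    exact (le_total 1 (a 1)).imp_right fun h => (a.le_symm_apply).2 h
  · rw [mem_pointCone, orderIso_inf_apply]
    exact le_inf ha hb
  · obtain ⟨e, he⟩ : ∃ e, e ∉ C.1 := by
      by_contra! h
      exact C.2.ne_top (eq_top_iff.2 fun x _ => h x)
    exact ⟨e, fun h => he ((hmem e).1 h)⟩

theorem exists_isPrimeCone_of_linearOrder (C : RightOrders (eta V G).range)
    (hC : ∀ a ∈ C.1, ∀ g, g * a * g⁻¹ ∈ C.1) (hV : V C.Chain) :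
    ∃ P : Submonoid (Free V G), IsPrimeCone P ∧ P.comap (eta V G).range.subtype = C.1 := by
  have := C.mulRightMono_chain hC
  obtain ⟨f, hf, hfe⟩ := exists_isLHom_extension hV C.toChain.toMonoidHom C.toChain_monotone
  obtain ⟨e, he⟩ : ∃ e, e ∉ C.1 := by
    by_contra! h
    exact C.2.ne_top (eq_top_iff.2 fun x _ => h x)
  obtain ⟨P, hP, -, hPf⟩ := hf.exists_isPrimeCone ⟨e, fun h => he (by
    rw [hfe] at h
    exact C.one_le_toChain.1 h.ge)⟩
  refine ⟨P, hP, Submonoid.ext fun e => ?_⟩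
  rw [Submonoid.mem_comap, hPf, ← C.one_le_toChain]
  exact iff_of_eq (congrArg (1 ≤ ·) (hfe e))

theorem representableLGroups_of_linearOrder (T : Type u) [Group T] [LinearOrder T] [MulLeftMono T]
    [MulRightMono T] : RepresentableLGroups T :=
  ⟨PUnit, fun _ => T, fun _ => inferInstance, fun _ => inferInstance, fun _ => inferInstance,
    fun _ => inferInstance, fun _ => MonoidHom.id T,
    fun _ => ⟨⟨fun _ _ => rfl, fun _ _ => rfl⟩, Function.surjective_id⟩, fun _ _ h => h ⟨⟩⟩

theorem RepresentableLGroups.exists_isPrimeCone_notMem_core {H : Type u} [Group H] [Lattice H]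
    (hH : RepresentableLGroups H) {x : H} (hx : x ≠ 1) :
    ∃ P : Submonoid H, IsPrimeCone P ∧ (∀ a ∈ P, ∀ g, g * a * g⁻¹ ∈ P) ∧ x ∉ core P := by
  obtain ⟨ι, T, _, _, _, _, f, hf, hsep⟩ := hH
  obtain ⟨i, hi⟩ : ∃ i, f i x ≠ 1 := by
    by_contra! h
    exact hx (hsep x 1 fun i => by rw [h, map_one])
  obtain ⟨P, hP, hconj, hmem⟩ := (hf i).1.exists_isPrimeCone ⟨x, hi⟩
  refine ⟨P, hP, hconj, fun h => hi (le_antisymm ?_ ((hmem x).1 h.1))⟩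
  simpa using (hmem x⁻¹).1 h.2

theorem nonempty_minSpec_homeomorph_orders {H : Type*} [Group H] [Lattice H] [MulLeftMono H]
    [MulRightMono H] {E : Subgroup H} (hE : LGenerates E)
    (hsep : ∀ x : H, x ≠ 1 →
      ∃ P : Submonoid H, IsPrimeCone P ∧ (∀ a ∈ P, ∀ g, g * a * g⁻¹ ∈ P) ∧ x ∉ core P)
    (hex : ∀ C : RightOrders E, (∀ a ∈ C.1, ∀ g, g * a * g⁻¹ ∈ C.1) →
      ∃ P : Submonoid H, IsPrimeCone P ∧ P.comap E.subtype = C.1) :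
    Nonempty (MinSpec H ≃ₜ Orders E) := by
  choose N hN hconj hx using fun x : {x : H // x ≠ 1} => hsep x.1 x.2
  obtain ⟨φ⟩ := nonempty_minSpec_homeomorph hE ⊤ hN (fun i a ha g _ => hconj i a ha g)
    (fun x h => ⟨⟨x, h⟩, hx ⟨x, h⟩⟩) (fun C hC => hex C fun a ha g => hC a ha g trivial)
  have hset : ∀ C : RightOrders E, (∀ a ∈ C.1, ∀ g ∈ (⊤ : Subgroup E), g * a * g⁻¹ ∈ C.1) ↔
      ∀ a ∈ C.1, ∀ g : E, g * a * g⁻¹ ∈ C.1 := fun C => by simp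
  exact ⟨φ.trans ((Homeomorph.refl (RightOrders E)).subtype hset)⟩

end FreeGeneration

end LatticeGroup

theorem corollary5p11 (G : Type*) [Group G] [PartialOrder G] [MulLeftMono G] [MulRightMono G] :
    Nonempty (MinSpec (Free AllLGroups G) ≃ₜ RightOrders (eta AllLGroups G).range) ∧
    Nonempty (MinSpec (Free RepresentableLGroups G) ≃ₜ
      Orders (eta RepresentableLGroups G).range) ∧
    Nonempty (MinSpec (Free AbelianLGroups G) ≃ₜ Orders (eta AbelianLGroups G).range) := by
  refine ⟨?_, ?_, ?_⟩
  · choose N hN hx using fun x : {x : Free AllLGroups G // x ≠ 1} =>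
      exists_isPrimeCone_notMem_core x.2
    obtain ⟨φ⟩ := nonempty_minSpec_homeomorph (lGenerates_range_eta AllLGroups G) ⊥ hN
      (fun i a ha g hg => by
        rw [Subgroup.mem_bot] at hg
        simpa [hg] using ha)
      (fun x h => ⟨⟨x, h⟩, hx ⟨x, h⟩⟩) (fun C _ => exists_isPrimeCone_of_allLGroups C)
    refine ⟨(φ.trans ((Homeomorph.refl _).subtype (q := fun _ => True) fun C => ?_)).trans
      (Homeomorph.Set.univ _)⟩
    simp
  · exact nonempty_minSpec_homeomorph_orders (lGenerates_range_eta _ G)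
      (fun x hx => (representableLGroups_free G).exists_isPrimeCone_notMem_core hx)
      (fun C hC => have := C.mulRightMono_chain hC
        exists_isPrimeCone_of_linearOrder C hC (representableLGroups_of_linearOrder _))
  · have hcomm := abelianLGroups_free G
    refine nonempty_minSpec_homeomorph_orders (lGenerates_range_eta _ G) (fun x hx => ?_)
      (fun C hC => exists_isPrimeCone_of_linearOrder C hC fun a b => ?_)
    · obtain ⟨P, hP, hxP⟩ := exists_isPrimeCone_notMem_core hx
      exact ⟨P, hP, fun a ha g => by rwa [hcomm g a, mul_inv_cancel_right], hxP⟩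
    · exact C.toChain.symm.injective (Subtype.ext (by simpa using hcomm _ _))
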